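/- **Conventions.** Let $\mathbb F_{q^n}\subseteq\mathbb F_{q^m}$ ($n\mid m$) and $\sigma\colon x\mapsto x^{q^s}$. For $v\in\mathbb F_{q^m}^n$ let $\mathrm{rk}(v)=\dim_{\mathbb F_q}\langle v_1,\dots,v_n\rangle_{\mathbb F_q}$, $d(u,v)=\mathrm{rk}(u-v)$ and $B_\tau(w)=\{c:\mathrm{rk}(w-c)\le\tau\}$. Let $\mathcal L_{m,\sigma}$ be the set of maps $\mathbb F_{q^m}\to\mathbb F_{q^m}$ of the form $x\mapsto\sum_i a_i x^{\sigma^i}$, $a_i\in\mathbb F_{q^m}$. For a field $\mathbb F_q\subseteq E\subseteq\mathbb F_{q^m}$ put $\mathcal G_{E,h,\sigma}=\{\sum_{i=0}^{h-1}a_ix^{\sigma^i}: a_i\in E\}$ (so $\mathcal G_{\mathbb F_{q^n},h,\sigma}$ is the generalized Gabidulin code $\mathcal G_{n,h,\sigma}$), and $S^{\sigma^j}=\{f(x)^{\sigma^j}:f\in S\}$. For $\mathcal C\subseteq\mathcal L_{m,\sigma}$, the evaluation code of $\mathcal C$ over $\alpha_1,\dots,\alpha_n$ is $\{(g(\alpha_1),\dots,g(\alpha_n)):g\in\mathcal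 C\}$. A list decoding algorithm for a code $\mathrm C\subseteq\mathbb F_{q^m}^n$ at radius $\tau$ writes down, for each $w\in\mathbb F_{q^m}^n$, a list of all codewords in $\mathrm C\cap B_\tau(w)$; it is a Turing machine whose tape cells hold symbols of $\mathbb F_{q^m}$ (or one of finitely many auxiliary symbols), one step moving the head or writing one cell. A family of codes is efficiently list decodable at given radii if its members have such algorithms whose running times are bounded by one polynomial in the length $n$ of the code. **Theorem.** Let $p$ be a prime, $q$ a power of $p$, $k,t$ positive integers, $q'=p^r$ with $r\ge 0$, $p_i=1+q'+\dots+q'^i$, $n=tp_k$, and $m$ a multiple of $n$. Let $s$ be a positive integer coprime with $n$, and $\sigma\colon x\mapsto x^{q^s}$. Let $\mathcal C\subseteq\mathcal L_{m,\sigma}$ and let $\mathrm C$ be the evaluation code of $\mathcal C$ over an $\mathbb F_q$-basis of $\beta\mathbb F_{q^n}$, for some $\beta\in\mathbb F_{q^m}^*$, with minimum distance $d$. Suppose that 1. $\lfloor\frac{d-1}{2}\rfloor+1\le tq'^k\le d-1$; 2. $(\mathcal G_{E,\,t(p_{k-1}-p_0)+1,\,\sigma})^{\sigma^j}\subseteq\mathcal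 C$ for some integer $0\le j<tq'^k$, where $E=\mathbb F_{q^n}(\beta)$ (so $E=\mathbb F_{q^n}$ if $\beta\in\mathbb F_{q^n}$; and the condition holds whenever $\mathcal C$ contains the corresponding code with coefficients in $\mathbb F_{q^m}$). Then $\mathrm C$ cannot be list decoded efficiently at any radius $\tau\ge tq'^k$. That is: for each such $\mathrm C$ and $\tau$ there is a word $w\in\mathbb F_{q^m}^n\setminus\mathrm C$ with $|\mathrm C\cap B_\tau(w)|\ge\frac{q^n-1}{q^t-1}$; and no family of such codes $\mathrm C$ with unbounded lengths $n$ (all parameters may vary along the family) is efficiently list decodable at any choice of radii $\tau\ge tq'^k$. -/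

import Mathlib

noncomputable section

namespace RankMetric

universe u v w

section Codes

variable (K : Type u) {L : Type v} [Field K] [Field L] [Algebra K L] {n : ℕ}

/-- The rank weight of `v = (v₁, …, vₙ)`: the `K`-dimension of the span of its entries. -/
def rankWeight (v : Fin n → L) : ℕ :=
  Module.finrank K (Submodule.span K (Set.range v))

/-- The rank distance `rk (u - v)`. -/
def rankDist (u v : Fin n → L) : ℕ :=
  rankWeight K (u - v)

/-- The ball `B_τ(w)` of radius `τ` around `w` in the rank metric. -/
def rankBall (w : Fin n → L) (τ : ℕ) : Set (Fin n → L) :=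
  {c | rankDist K w c ≤ τ}

/-- The minimum distance of a rank-metric code. -/
def minDist (C : Set (Fin n → L)) : ℕ :=
  sInf {d | ∃ u ∈ C, ∃ v ∈ C, u ≠ v ∧ d = rankDist K u v}

end Codes

section SigmaPolynomials

variable {K : Type u} {L : Type v} [Field K] [Field L] [Algebra K L]

/-- The endomorphism `x ↦ ∑_{i < h} aᵢ x^{σ^i}` of `L` represented by a `σ`-polynomial. -/
def sigmaPoly (σ : L ≃ₐ[K] L) (h : ℕ) (a : Fin h → L) : L →ₗ[K] L :=
  ∑ i : Fin h, a i • (σ ^ (i : ℕ)).toLinearMap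

/-- All endomorphisms of `L` represented by `σ`-polynomials with coefficients in `L`
(the algebra `𝓛_{m,σ}`, where `m = [L : K]`). -/
def sigmaPolynomials (σ : L ≃ₐ[K] L) : Set (L →ₗ[K] L) :=
  {f | ∃ (h : ℕ) (a : Fin h → L), f = sigmaPoly σ h a}

/-- The generalized Gabidulin code of the `σ`-polynomials `∑_{i < h} aᵢ x^{σ^i}` whose
coefficients lie in the intermediate field `E`. It is `𝓖_{n,h,σ}` for `E = 𝔽_{q^n}` and
`𝓖_{m,h,σ}` for `E = L`. -/
def gabidulin (σ : L ≃ₐ[K] L) (E : IntermediateField K L) (h : ℕ) : Set (L →ₗ[K] L) :=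
  {f | ∃ a : Fin h → L, (∀ i, a i ∈ E) ∧ f = sigmaPoly σ h a}

/-- `S^{σ^j} = {f(x)^{σ^j} : f ∈ S}`. -/
def sigmaTwist (σ : L ≃ₐ[K] L) (j : ℕ) (S : Set (L →ₗ[K] L)) : Set (L →ₗ[K] L) :=
  {g | ∃ f ∈ S, g = (σ ^ j).toLinearMap ∘ₗ f}

/-- The evaluation code `{(g(α₁), …, g(αₙ)) : g ∈ 𝒞}`. -/
def evalCode {n : ℕ} (α : Fin n → L) (𝒞 : Set (L →ₗ[K] L)) : Set (Fin n → L) :=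
  {c | ∃ g ∈ 𝒞, c = fun i => g (α i)}

end SigmaPolynomials

/-- `p_i = 1 + q' + q'^2 + ⋯ + q'^i`. -/
def geomSum (q' i : ℕ) : ℕ :=
  ∑ j ∈ Finset.range (i + 1), q' ^ j

section ListDecoding

/-- A deterministic one-tape Turing machine with finitely many states. A tape cell holds a blank
(`none`), a symbol of the code alphabet `L`, or one of finitely many auxiliary work symbols. One
step moves the head by one cell or writes one cell. -/
structure DecodingMachine (L : Type v) where
  /-- the states; the default state is the initial one -/
  State : Type
  /-- the auxiliary work symbols -/
  Work : Type
  [stateInhabited : Inhabited State]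
  [stateFinite : Finite State]
  [workFinite : Finite Work]
  /-- the transition function -/
  machine : Turing.TM0.Machine (Option (L ⊕ Work)) State

attribute [instance] DecodingMachine.stateInhabited

namespace DecodingMachine

variable {L : Type v} (M : DecodingMachine L)

/-- A word over `L` written on consecutive tape cells. -/
def tapeWord (x : List L) : List (Option (L ⊕ M.Work)) :=
  x.map fun a => some (Sum.inl a)

/-- Started on the input word `x`, the machine halts after at most `T` steps with the output word
`y` on its tape, read from the head to the right, and followed by blanks only. -/
def OutputsWithin (x y : List L) (T : ℕ) : Prop :=
  ∃ c : Turing.TM0.Cfg (Option (L ⊕ M.Work)) M.State,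
    Nonempty (StateTransition.EvalsToInTime (Turing.TM0.step M.machine)
      (Turing.TM0.init (M.tapeWord x)) (some c) T) ∧
    Turing.TM0.step M.machine c = none ∧
    c.Tape.right₀ = Turing.ListBlank.mk (M.tapeWord y)

/-- The machine list decodes `C` at radius `τ` within `T` steps: on every received word `w` it
writes down, one after the other, the codewords at rank distance at most `τ` from `w`. -/
def ListDecodes (K : Type u) [Field K] [Field L] [Algebra K L] {n : ℕ}
    (C : Set (Fin n → L)) (τ T : ℕ) : Prop :=
  ∀ w : Fin n → L, ∃ ℓ : List (Fin n → L),
    (∀ c, c ∈ ℓ ↔ c ∈ C ∩ rankBall K w τ) ∧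
    M.OutputsWithin (List.ofFn w) (ℓ.flatMap fun c => List.ofFn c) T

end DecodingMachine

/-- A family of rank-metric codes `C i`, of length `n i` over `L i`, is efficiently list decodable
at the radii `τ i` if every `C i` has a list decoding algorithm at radius `τ i` such that the
running times of these algorithms are bounded by one polynomial in the length `n i`. -/
def EfficientlyListDecodable {ι : Type w} (K : ι → Type u) {L : ι → Type v}
    [∀ i, Field (K i)] [∀ i, Field (L i)] [∀ i, Algebra (K i) (L i)] {n : ι → ℕ}
    (C : ∀ i, Set (Fin (n i) → L i)) (τ : ι → ℕ) : Prop :=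
  ∃ P : Polynomial ℕ, ∀ i, ∃ M : DecodingMachine (L i),
    M.ListDecodes (K i) (C i) (τ i) (P.eval (n i))

end ListDecoding

end RankMetric

end

/-! Put `e = p_{k-1}`, `P = p_k`, so that `n - te = t q'^k`. A generator of Gal(N/K), raised to the
power `t`, gives `T` of order `P` with fixed field `F` of degree `t` over `K`. Since `e < P`, some
monic `T`-polynomial `f` of degree `e` with nonzero constant term has kernel of `K`-dimension at
least `te` (`AlgEquiv.exists_monic_finrank_le_ker`). For `γ ≠ 0` the map `T^e(γ) f(γ⁻¹x)` is again
monic of rank at most `n - te`. Subtracting it from `T^e` leaves `T`-degree at most `e - 1`, so it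
yields a codeword near the single word given by `σ^{te}`, up to the twists by `β` and `σ^j`.
Comparing constant terms, `γ` and `δ` can share a codeword only if `γ⁻¹δ` is fixed by `T^e`; as `e`
is prime to `P`, this puts `γ⁻¹δ` in `F`. Fibres thus have at most `q^t - 1` elements
(`exists_word_le_ncard_inter_rankBall`).

The list is exponentially long in `n`, while a machine fills at most one new cell per step, so
polynomial time cannot suffice. -/

/-! ### Nonblank tape cells during a computation -/

namespace Turing

variable {Γ : Type*} [Inhabited Γ]

/-- At most `b` cells of the tape are nonblank. -/
def Tape.NonblankLE (T : Tape Γ) (b : ℕ) : Prop :=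
  ∃ S : Finset ℤ, S.card ≤ b ∧ ∀ i ∉ S, T.nth i = default

theorem Tape.NonblankLE.mono {T : Tape Γ} {a b : ℕ} (h : T.NonblankLE a) (hab : a ≤ b) :
    T.NonblankLE b :=
  let ⟨S, hS, hT⟩ := h
  ⟨S, hS.trans hab, hT⟩

theorem Tape.NonblankLE.move {T : Tape Γ} {b : ℕ} (h : T.NonblankLE b) (d : Dir) :
    (T.move d).NonblankLE b := by
  classical
  obtain ⟨S, hS, hT⟩ := h
  cases d with
  | left =>
    refine ⟨S.image (· + 1), Finset.card_image_le.trans hS, fun i hi => ?_⟩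
    rw [Tape.move_left_nth]
    exact hT _ fun h' => hi (Finset.mem_image.2 ⟨i - 1, h', by ring⟩)
  | right =>
    refine ⟨S.image (· - 1), Finset.card_image_le.trans hS, fun i hi => ?_⟩
    rw [Tape.move_right_nth]
    exact hT _ fun h' => hi (Finset.mem_image.2 ⟨i + 1, h', by ring⟩)

theorem Tape.NonblankLE.write {T : Tape Γ} {b : ℕ} (h : T.NonblankLE b) (a : Γ) :
    (T.write a).NonblankLE (b + 1) := by
  classical
  obtain ⟨S, hS, hT⟩ := h
  refine ⟨insert 0 S, (Finset.card_insert_le _ _).trans (Nat.succ_le_succ hS), fun i hi => ?_⟩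
  rw [Finset.mem_insert, not_or] at hi
  rw [Tape.write_nth, if_neg hi.1]
  exact hT i hi.2

theorem Tape.nonblankLE_mk₁ (l : List Γ) : (Tape.mk₁ l).NonblankLE l.length := by
  classical
  refine ⟨(Finset.range l.length).image (fun k : ℕ => (k : ℤ)),
    Finset.card_image_le.trans (Finset.card_range _).le, fun i hi => ?_⟩
  rcases i with k | k
  · have hk : l.length ≤ k := by
      by_contra! hk
      exact hi (Finset.mem_image.2 ⟨k, Finset.mem_range.2 hk, rfl⟩)
    rw [Int.ofNat_eq_natCast, Tape.mk₁, Tape.mk₂, Tape.mk'_nth_nat, ListBlank.nth_mk,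
      List.getI_eq_default _ hk]
  · rw [Tape.mk₁, Tape.mk₂]
    change (Tape.mk' (ListBlank.mk []) (ListBlank.mk l)).left.nth k = default
    rw [Tape.mk'_left, ListBlank.nth_mk, List.getI_nil]

theorem Tape.NonblankLE.length_le {T : Tape Γ} {b : ℕ} (h : T.NonblankLE b) (l : List Γ)
    (hl : ∀ a ∈ l, a ≠ default) (hT : T.right₀ = ListBlank.mk l) : l.length ≤ b := by
  classical
  obtain ⟨S, hS, hd⟩ := h
  have hsub : (Finset.range l.length).image (fun k : ℕ => (k : ℤ)) ⊆ S := by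
    intro i hi
    obtain ⟨k, hk, rfl⟩ := Finset.mem_image.1 hi
    by_contra hkS
    have h₁ := hd _ hkS
    rw [← Tape.right₀_nth, hT, ListBlank.nth_mk,
      List.getI_eq_getElem _ (Finset.mem_range.1 hk)] at h₁
    exact hl _ (List.getElem_mem _) h₁
  have := Finset.card_le_card hsub
  rw [Finset.card_image_of_injective _ Nat.cast_injective, Finset.card_range] at this
  exact this.trans hS

variable {Λ : Type*} [Inhabited Λ]

theorem TM0.step_nonblankLE {M : TM0.Machine Γ Λ} {c c' : TM0.Cfg Γ Λ} {b : ℕ}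
    (hc : c.Tape.NonblankLE b) (h : TM0.step M c = some c') : c'.Tape.NonblankLE (b + 1) := by
  obtain ⟨q, T⟩ := c
  simp only [TM0.step, Option.map_eq_some_iff] at h
  obtain ⟨⟨q', a⟩, -, rfl⟩ := h
  cases a with
  | move d => exact (hc.move d).mono (Nat.le_succ b)
  | write a => exact hc.write a

theorem TM0.iterate_step_nonblankLE {M : TM0.Machine Γ Λ} {c c' : TM0.Cfg Γ Λ} {b : ℕ}
    (hc : c.Tape.NonblankLE b) (k : ℕ)
    (h : (flip bind (TM0.step M))^[k] (some c) = some c') : c'.Tape.NonblankLE (b + k) := by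
  induction k generalizing c' with
  | zero =>
    obtain rfl : c = c' := by simpa using h
    exact hc
  | succ k ih =>
    rw [Function.iterate_succ_apply'] at h
    obtain ⟨c₁, h₁, h₂⟩ := Option.bind_eq_some_iff.1 h
    exact step_nonblankLE (ih h₁) h₂

end Turing

/-! ### List size, running time and polynomial growth -/

namespace RankMetric

theorem DecodingMachine.OutputsWithin.length_le {L : Type*} {M : DecodingMachine L}
    {x y : List L} {T : ℕ} (h : M.OutputsWithin x y T) : y.length ≤ x.length + T := by
  obtain ⟨c, ⟨e⟩, -, hc⟩ := h
  have h₀ := Turing.Tape.nonblankLE_mk₁ (M.tapeWord x)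
  have h₁ := (Turing.TM0.iterate_step_nonblankLE (c := Turing.TM0.init (M.tapeWord x)) h₀
    e.steps e.evals_in_steps).mono (Nat.add_le_add_left e.steps_le_m _)
  have h₂ := h₁.length_le (M.tapeWord y) (by
    intro a ha
    obtain ⟨b, -, rfl⟩ := List.mem_map.1 ha
    exact Option.some_ne_none _) hc
  simpa [DecodingMachine.tapeWord] using h₂

/-- Each listed codeword occupies `n` nonblank cells, and only `n + T` cells can be nonblank after
`T` steps. -/
theorem DecodingMachine.ListDecodes.ncard_mul_le {K L : Type*} [Field K] [Field L] [Algebra K L]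
    {n τ T : ℕ} {M : DecodingMachine L} {C : Set (Fin n → L)} (h : M.ListDecodes K C τ T)
    (w : Fin n → L) : (C ∩ rankBall K w τ).ncard * n ≤ n + T := by
  classical
  obtain ⟨ℓ, hℓ, ho⟩ := h w
  have h₁ : (C ∩ rankBall K w τ).ncard ≤ ℓ.length := by
    have : C ∩ rankBall K w τ = (ℓ.toFinset : Set (Fin n → L)) := by
      ext c
      simp [hℓ]
    rw [this, Set.ncard_coe_finset]
    exact ℓ.toFinset_card_le
  have h₂ := ho.length_le
  rw [List.length_flatMap, List.length_ofFn] at h₂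
  simp only [List.length_ofFn, List.map_const', List.sum_replicate, smul_eq_mul] at h₂
  exact (Nat.mul_le_mul_right n h₁).trans h₂

theorem _root_.Polynomial.isLittleO_eval_const_pow (P : Polynomial ℕ) {r : ℝ} (hr : 1 < r) :
    (fun n : ℕ => ((P.eval n : ℕ) : ℝ)) =o[Filter.atTop] fun n : ℕ => r ^ n := by
  induction P using Polynomial.induction_on' with
  | add P Q hP hQ => simpa using hP.add hQ
  | monomial k a => simpa using (isLittleO_pow_const_const_pow_of_one_lt k hr).const_mul_left (a : ℝ)

theorem exists_forall_add_eval_lt_two_pow (P : Polynomial ℕ) :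
    ∃ B : ℕ, ∀ n t : ℕ, B ≤ n → 2 * t ≤ n → n + P.eval n < 2 ^ (n - t) := by
  -- The square absorbs the loss of `t` in the exponent: `2 * t ≤ n` gives `2 ^ n ≤ (2 ^ (n - t)) ^
  -- 2`.
  have h := ((Polynomial.X + P) ^ 2).isLittleO_eval_const_pow one_lt_two |>.bound
    (c := 1 / 2) (by norm_num)
  obtain ⟨B, hB⟩ := Filter.eventually_atTop.1 h
  refine ⟨B, fun n t hn ht => ?_⟩
  have h₁ := hB n hn
  rw [Real.norm_natCast, Real.norm_of_nonneg (by positivity)] at h₁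
  have h₂ : (0 : ℝ) < 2 ^ n := by positivity
  have h₃ : ((((Polynomial.X + P) ^ 2).eval n : ℕ) : ℝ) < 2 ^ n := by linarith
  have h₄ : (n + P.eval n) ^ 2 < 2 ^ n := by
    rw [Polynomial.eval_pow, Polynomial.eval_add, Polynomial.eval_X] at h₃
    exact_mod_cast h₃
  refine lt_of_pow_lt_pow_left₀ 2 (by positivity) (h₄.trans_le ?_)
  rw [← pow_mul]
  exact Nat.pow_le_pow_right two_pos (by omega)

end RankMetric

/-! ### Polynomials in an automorphism and their kernels -/

open IntermediateField Module

/-- Dedekind independence: powers of `τ` below its order are distinct automorphisms. -/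
theorem AlgEquiv.eq_zero_of_sum_mul_pow_apply_eq_zero {K A : Type*} [Field K] [Field A]
    [Algebra K A] (τ : A ≃ₐ[K] A) {e : ℕ} (he : e ≤ orderOf τ) (b : ℕ → A)
    (h : ∀ x : A, ∑ i ∈ Finset.range e, b i * (τ ^ i) x = 0) : ∀ i < e, b i = 0 := by
  have hinj : Function.Injective
      (fun i : Fin e => ((τ ^ (i : ℕ) : A ≃ₐ[K] A) : A →ₐ[K] A)) := by
    intro i j hij
    have h₁ : τ ^ (i : ℕ) = τ ^ (j : ℕ) := AlgEquiv.coe_toAlgHom_injective hij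
    exact Fin.ext (pow_injOn_Iio_orderOf (i.2.trans_le he) (j.2.trans_le he) h₁)
  have hli := (linearIndependent_toLinearMap K A A).comp _ hinj
  rw [Fintype.linearIndependent_iff] at hli
  intro i hi
  refine hli (fun i => b i) ?_ ⟨i, hi⟩
  ext x
  have := h x
  rw [Finset.sum_range] at this
  simpa using this

section Kernels

variable {K N : Type*} [Field K] [Field N] [Algebra K N]

theorem AlgEquiv.mem_fixedField_zpowers (τ : N ≃ₐ[K] N) (x : N) :
    x ∈ fixedField (Subgroup.zpowers τ) ↔ τ x = x := by
  constructor
  · intro h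
    exact h ⟨τ, Subgroup.mem_zpowers τ⟩
  · rintro h ⟨g, hg⟩
    have hle : Subgroup.zpowers τ ≤ MulAction.stabilizer (N ≃ₐ[K] N) x := by
      rw [Subgroup.zpowers_le]
      exact h
    exact hle hg

/-- For every `e` less than the order of `τ` there is a monic polynomial of degree `e` in `τ`, with
nonzero constant coefficient, whose kernel has dimension at least `e` over the fixed field. -/
theorem AlgEquiv.exists_monic_finrank_le_ker [FiniteDimensional K N] (τ : N ≃ₐ[K] N) (e : ℕ)
    (he : e < orderOf τ) :
    ∃ (a : ℕ → N) (f : N →ₗ[K] N), a 0 ≠ 0 ∧ a e = 1 ∧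
      (∀ x, f x = ∑ i ∈ Finset.range (e + 1), a i * (τ ^ i) x) ∧
      e * finrank K (fixedField (Subgroup.zpowers τ)) ≤ finrank K (LinearMap.ker f) := by
  induction e with
  | zero =>
    exact ⟨fun _ => 1, LinearMap.id, one_ne_zero, rfl, fun x => by simp, by simp⟩
  | succ e ih =>
    obtain ⟨a, f, ha₀, hae, hf, hker⟩ := ih (by omega)
    obtain ⟨v, hv⟩ : ∃ v, f v ≠ 0 := by
      by_contra! h
      exact ha₀ (τ.eq_zero_of_sum_mul_pow_apply_eq_zero he.le a
        (fun x => by rw [← hf, h]) 0 e.succ_pos)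
    -- With this `c`, the map `τ - c` kills `f v`. By `F`-linearity of `f`, the kernel of `(τ - c) ∘
    -- f` then gains the whole line `F v`.
    set c : N := τ (f v) / f v with hc
    have hτv : τ (f v) ≠ 0 := by simpa using hv
    have hc₀ : c ≠ 0 := div_ne_zero hτv hv
    set F := fixedField (Subgroup.zpowers τ) with hF
    have hfix : ∀ y : F, τ (y : N) = y := fun y => (τ.mem_fixedField_zpowers _).1 y.2
    have hfixpow : ∀ (y : F) (i : ℕ), (τ ^ i) (y : N) = y := by
      intro y i
      induction i with
      | zero => rfl
      | succ i ih => rw [pow_succ', AlgEquiv.mul_apply, ih, hfix]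
    have hfsmul : ∀ (y : F) (x : N), f (y * x) = y * f x := by
      intro y x
      rw [hf, hf, Finset.mul_sum]
      refine Finset.sum_congr rfl fun i _ => ?_
      rw [map_mul, hfixpow]
      ring
    -- Coefficients of `τ ∘ f` (shifted by one) minus those of `c f`. The guards cut off the values
    -- of `a` outside `0, …, e`, so the constant term is `-c * a 0`.
    refine ⟨fun i => (if i = 0 then 0 else τ (a (i - 1))) - (if i = e + 1 then 0 else c * a i),
      (τ.toLinearMap - LinearMap.mulLeft K c) ∘ₗ f, ?_, ?_, ?_, ?_⟩
    · simpa using ⟨hc₀, ha₀⟩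
    · simp [hae]
    · intro x
      have h₁ : ∑ i ∈ Finset.range (e + 1 + 1), (if i = 0 then 0 else τ (a (i - 1))) * (τ ^ i) x
          = τ (f x) := by
        rw [Finset.sum_range_succ', hf, map_sum]
        simp [pow_succ']
      have h₂ : ∑ i ∈ Finset.range (e + 1 + 1), (if i = e + 1 then 0 else c * a i) * (τ ^ i) x
          = c * f x := by
        rw [Finset.sum_range_succ, hf, Finset.mul_sum]
        simp only [if_true, zero_mul, add_zero]
        refine Finset.sum_congr rfl fun i hi => ?_
        rw [if_neg (Finset.mem_range.1 hi).ne, mul_assoc]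
      simp only [sub_mul, Finset.sum_sub_distrib]
      rw [h₁, h₂]
      simp
    · set g := (τ.toLinearMap - LinearMap.mulLeft K c) ∘ₗ f with hg
      have hgx : ∀ x, g x = τ (f x) - c * f x := fun x => by simp [hg]
      set V : Submodule K N := F.toSubalgebra.toSubmodule.map (LinearMap.mulRight K v) with hV
      have hv₀ : v ≠ 0 := by
        rintro rfl
        exact hv (map_zero f)
      have hVrank : finrank K V = finrank K F :=
        (Submodule.equivMapOfInjective _ (mul_left_injective₀ hv₀) _).finrank_eq.symm
      have hdisj : LinearMap.ker f ⊓ V = ⊥ := by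
        rw [eq_bot_iff]
        rintro _ ⟨h₁, y, hy, rfl⟩
        have h₂ : f ((⟨y, hy⟩ : F) * v) = 0 := h₁
        rw [hfsmul, mul_eq_zero, or_iff_left hv] at h₂
        have h₂' : y = 0 := h₂
        simp [h₂']
      have hle : LinearMap.ker f ⊔ V ≤ LinearMap.ker g := by
        refine sup_le (fun x hx => ?_) ?_
        · rw [LinearMap.mem_ker] at hx ⊢
          rw [hgx, hx]
          simp
        · rintro _ ⟨y, hy, rfl⟩
          change g ((⟨y, hy⟩ : F) * v) = 0
          rw [hgx, hfsmul, map_mul, hfix, hc]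
          field_simp
          ring
      have h₁ := Submodule.finrank_sup_add_finrank_inf_eq (LinearMap.ker f) V
      rw [hdisj, finrank_bot, hVrank] at h₁
      have h₂ := Submodule.finrank_mono hle
      rw [add_mul, one_mul]
      omega

end Kernels

/-- Serves to read a polynomial of degree `m` in `σ ^ t` as a `σ`-polynomial with `t * m + 1`
coefficients. -/
theorem Finset.sum_range_ite_dvd {M : Type*} [AddCommMonoid M] {t : ℕ} (ht : 0 < t) (m : ℕ)
    (F : ℕ → M) : ∑ i ∈ Finset.range (t * m + 1), (if t ∣ i then F i else 0) =
      ∑ l ∈ Finset.range (m + 1), F (t * l) := by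
  rw [← Finset.sum_filter]
  symm
  refine Finset.sum_nbij (t * ·) (fun l hl => ?_) (fun l _ l' _ h => Nat.eq_of_mul_eq_mul_left ht h)
    (fun i hi => ?_) (fun _ _ => rfl)
  · rw [Finset.mem_range, Nat.lt_succ_iff] at hl
    exact Finset.mem_filter.2
      ⟨Finset.mem_range.2 (Nat.lt_succ_of_le (Nat.mul_le_mul_left t hl)), Dvd.intro l rfl⟩
  · obtain ⟨h₁, l, rfl⟩ := Finset.mem_filter.1 hi
    rw [Finset.mem_range, Nat.lt_succ_iff] at h₁
    exact ⟨l, Finset.mem_coe.2 (Finset.mem_range.2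
      (Nat.lt_succ_of_le (Nat.le_of_mul_le_mul_left h₁ ht))), rfl⟩

section FrobeniusPower

variable {K L : Type*} [Field K] [Field L] [Finite L] [Algebra K L]

/-- A power of Frobenius with exponent prime to `[N : K]` restricts to a generator of
`Gal(N/K)`. -/
theorem IntermediateField.exists_restrict_orderOf_eq (N : IntermediateField K L) (σ : L ≃ₐ[K] L)
    {s : ℕ} (hσ : ∀ x, σ x = x ^ (Nat.card K ^ s)) (hs : s.Coprime (finrank K N)) :
    ∃ ρ : N ≃ₐ[K] N, orderOf ρ = finrank K N ∧ ∀ (i : ℕ) (x : N), ((ρ ^ i) x : L) = (σ ^ i) x := by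
  have : Finite K := Finite.of_injective _ (algebraMap K L).injective
  have := Fintype.ofFinite K
  set φ := FiniteField.frobeniusAlgEquivOfAlgebraic K N with hφ
  have hφpow : ∀ (i : ℕ) (x : N), (φ ^ i) x = x ^ (Nat.card K ^ i) := by
    intro i x
    induction i with
    | zero => simp
    | succ i ih =>
      rw [pow_succ', AlgEquiv.mul_apply, ih, hφ,
        FiniteField.frobeniusAlgEquivOfAlgebraic_apply, ← pow_mul, ← Nat.card_eq_fintype_card,
        pow_succ]
  refine ⟨φ ^ s, ?_, fun i x => ?_⟩
  · rw [Nat.Coprime.orderOf_pow, FiniteField.orderOf_frobeniusAlgEquivOfAlgebraic]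
    rw [FiniteField.orderOf_frobeniusAlgEquivOfAlgebraic]
    exact hs.symm
  · induction i with
    | zero => rfl
    | succ i ih =>
      rw [pow_succ', pow_succ', AlgEquiv.mul_apply, AlgEquiv.mul_apply, ← ih, hφpow, hσ]
      rfl

end FrobeniusPower

/-! ### The received word and its nearby codewords -/

namespace RankMetric

variable {K L : Type*} [Field K] [Field L] [Algebra K L]

theorem sigmaPoly_apply (σ : L ≃ₐ[K] L) (h : ℕ) (a : ℕ → L) (x : L) :
    sigmaPoly σ h (fun i => a i) x = ∑ i ∈ Finset.range h, a i * (σ ^ i) x := by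
  rw [Finset.sum_range]
  simp [sigmaPoly]

theorem rankWeight_comp_le {V : Type*} [AddCommGroup V] [Module K V] [FiniteDimensional K V]
    {n : ℕ} (f : V →ₗ[K] L) (y : Fin n → V) :
    rankWeight K (fun i => f (y i)) ≤ finrank K (LinearMap.range f) := by
  refine Submodule.finrank_mono (Submodule.span_le.2 ?_)
  rintro _ ⟨i, rfl⟩
  exact LinearMap.mem_range_self f (y i)

variable [Finite L]

/-- An evaluation code over a basis of `β N` that contains a twisted Gabidulin code has a ball of
radius `n - t e` with many codewords, around a word outside of the code. -/
theorem exists_word_le_ncard_inter_rankBall (N : IntermediateField K L) {n t e P s j τ : ℕ}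
    (hN : finrank K N = n) (hn : n = t * P) (ht : 0 < t) (he : 0 < e) (heP : e < P)
    (hcop : e.Coprime P) (hs : s.Coprime n) (σ : L ≃ₐ[K] L)
    (hσ : ∀ x, σ x = x ^ (Nat.card K ^ s)) (𝒞 : Set (L →ₗ[K] L)) {β : L} (hβ : β ≠ 0)
    (α : Fin n → L) (hα : LinearIndependent K α)
    (hspan : (Submodule.span K (Set.range α) : Set L) = (fun x => β * x) '' (N : Set L))
    (hd : n - t * e ≤ minDist K (evalCode α 𝒞) - 1)
    (hG : sigmaTwist σ j (gabidulin σ (N ⊔ IntermediateField.adjoin K {β}) (t * (e - 1) + 1)) ⊆ 𝒞)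
    (hτ : n - t * e ≤ τ) :
    ∃ w : Fin n → L, w ∉ evalCode α 𝒞 ∧
      (Nat.card K ^ n - 1) / (Nat.card K ^ t - 1) ≤ (evalCode α 𝒞 ∩ rankBall K w τ).ncard := by
  classical
  subst hN
  obtain ⟨ρ, hρ, hρσ⟩ := N.exists_restrict_orderOf_eq σ hσ hs
  set T := ρ ^ t with hT
  have hTσ : ∀ (i : ℕ) (x : N), ((T ^ i) x : L) = (σ ^ (t * i)) x := fun i x => by
    rw [hT, ← pow_mul, hρσ]
  have hTord : orderOf T = P := by
    rw [hT, orderOf_pow_of_dvd ht.ne' (by rw [hρ, hn]; exact Dvd.intro P rfl), hρ, hn,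
      Nat.mul_div_cancel_left _ ht]
  set F := fixedField (Subgroup.zpowers T) with hF
  have hFrank : finrank K F = t := by
    have h₁ := finrank_mul_finrank K F N
    rw [finrank_fixedField_eq_card, Nat.card_zpowers, hTord, hn] at h₁
    exact Nat.eq_of_mul_eq_mul_right (by omega) h₁
  obtain ⟨a, f, ha₀, hae, hf, hker⟩ := T.exists_monic_finrank_le_ker e (hTord ▸ heP)
  rw [← hF, hFrank] at hker
  -- the received word minus the codeword attached to `γ`, as a map on `N`
  let D : N → N →ₗ[K] L := fun γ => ((σ ^ j).toLinearMap ∘ₗ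
    LinearMap.mulLeft K ((σ ^ (t * e)) (β * γ)) ∘ₗ N.val.toLinearMap) ∘ₗ
      (f ∘ₗ LinearMap.mulLeft K γ⁻¹)
  have hD : ∀ γ x, D γ x = (σ ^ j) ((σ ^ (t * e)) (β * γ) * f (γ⁻¹ * x)) := fun _ _ => rfl
  have hDrank : ∀ γ, finrank K (LinearMap.range (D γ)) ≤ finrank K N - t * e := by
    intro γ
    have h₁ := LinearMap.finrank_range_add_finrank_ker f
    have h₂ : finrank K (LinearMap.range (D γ)) ≤ finrank K (LinearMap.range f) := by
      refine le_trans ?_ (Submodule.finrank_map_le ((σ ^ j).toLinearMap ∘ₗ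
        LinearMap.mulLeft K ((σ ^ (t * e)) (β * γ)) ∘ₗ N.val.toLinearMap) (LinearMap.range f))
      refine Submodule.finrank_mono ?_
      rintro _ ⟨x, rfl⟩
      exact ⟨_, LinearMap.mem_range_self f (γ⁻¹ * x), rfl⟩
    rw [mul_comm] at hker
    omega
  have hy : ∀ i, ∃ y : N, α i = β * y := by
    intro i
    have h₁ : α i ∈ (Submodule.span K (Set.range α) : Set L) := Submodule.subset_span ⟨i, rfl⟩
    rw [hspan] at h₁
    obtain ⟨y, hy, h₂⟩ := h₁
    exact ⟨⟨y, hy⟩, h₂.symm⟩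
  choose y hy using hy
  have hyspan : Submodule.span K (Set.range y) = ⊤ := by
    refine LinearIndependent.span_eq_top_of_card_eq_finrank' ?_ (Fintype.card_fin _)
    refine LinearIndependent.of_comp (LinearMap.mulLeft K β ∘ₗ N.val.toLinearMap) ?_
    have h₁ : ⇑(LinearMap.mulLeft K β ∘ₗ N.val.toLinearMap) ∘ y = α := funext fun i => (hy i).symm
    rwa [h₁]
  have hDinj : ∀ γ₁ γ₂, (∀ i, D γ₁ (y i) = D γ₂ (y i)) → D γ₁ = D γ₂ := fun γ₁ γ₂ h =>
    LinearMap.ext_on_range hyspan h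
  let w : Fin (finrank K N) → L := fun i => (σ ^ j) ((σ ^ (t * e)) (α i))
  -- The negated lower coefficients of the monic map attached to `γ`, rescaled by `β` because the
  -- evaluation points are `β * y i`.
  let b : N → ℕ → L := fun γ i => if t ∣ i then
    -((σ ^ (t * e)) (β * γ) * a (i / t) * (σ ^ i) (β * γ)⁻¹) else 0
  let c : N → Fin (finrank K N) → L := fun γ i =>
    (σ ^ j) (sigmaPoly σ (t * (e - 1) + 1) (fun i => b γ i) (α i))
  have hwc : ∀ γ ≠ 0, ∀ i, (w - c γ) i = D γ (y i) := by
    intro γ hγ i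
    have hγ' : (γ : L) ≠ 0 := by simpa using hγ
    rw [hD, Pi.sub_apply, ← map_sub, sigmaPoly_apply]
    congr 1
    simp only [b, ite_mul, zero_mul]
    rw [Finset.sum_range_ite_dvd ht (e - 1) (fun i =>
      -((σ ^ (t * e)) (β * γ) * a (i / t) * (σ ^ i) (β * γ)⁻¹) * (σ ^ i) (α _)),
      Nat.sub_add_cancel he, hf, Finset.sum_range_succ, hae, one_mul]
    have h₁ : ∀ l, (σ ^ (t * l)) (β * (γ : L))⁻¹ * (σ ^ (t * l)) (α i) =
        ((T ^ l) (γ⁻¹ * y i) : N) := by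
      intro l
      rw [hTσ, ← map_mul, hy]
      congr 1
      push_cast
      field_simp
    have h₂ : (σ ^ (t * e)) (β * γ) * ((T ^ e) (γ⁻¹ * y i) : N) = (σ ^ (t * e)) (α i) := by
      rw [hTσ, ← map_mul, hy]
      congr 1
      push_cast
      field_simp
    push_cast
    rw [mul_add, h₂, Finset.mul_sum, add_comm, sub_eq_add_neg, ← Finset.sum_neg_distrib]
    congr 1
    refine Finset.sum_congr rfl fun l _ => ?_
    rw [Nat.mul_div_cancel_left _ ht, neg_mul, neg_neg, mul_assoc, h₁, mul_assoc]
  have hcC : ∀ γ, c γ ∈ evalCode α 𝒞 := by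
    intro γ
    refine ⟨_, hG ⟨sigmaPoly σ (t * (e - 1) + 1) (fun i => b γ i), ⟨_, fun i => ?_, rfl⟩, rfl⟩, rfl⟩
    set E := N ⊔ IntermediateField.adjoin K {β} with hE
    have hNE : N ≤ E := le_sup_left
    have hβE : β ∈ E := (le_sup_right : IntermediateField.adjoin K {β} ≤ E)
      (IntermediateField.mem_adjoin_simple_self K β)
    -- `σ` acts as a power map, so it preserves every intermediate field.
    have hσE : ∀ (i : ℕ) (x : L), x ∈ E → (σ ^ i) x ∈ E := by
      intro i x hx
      induction i with
      | zero => exact hx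
      | succ i ih =>
        rw [pow_succ', AlgEquiv.mul_apply, hσ]
        exact pow_mem ih _
    have hδ : β * (γ : L) ∈ E := mul_mem hβE (hNE γ.2)
    change (if _ then _ else _) ∈ E
    split_ifs
    · exact neg_mem (mul_mem (mul_mem (hσE _ _ hδ) (hNE (a _).2)) (hσE _ _ (inv_mem hδ)))
    · exact zero_mem E
  have hdist : ∀ γ ≠ 0, rankDist K w (c γ) ≤ finrank K N - t * e := by
    intro γ hγ
    have h₁ : w - c γ = fun i => D γ (y i) := funext (hwc γ hγ)
    rw [rankDist, h₁]
    exact (rankWeight_comp_le (D γ) y).trans (hDrank γ)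
  -- Makes the radius positive, so the truncated `minDist - 1` in `hd` is a genuine predecessor.
  have heP' : t * e < finrank K N := hn ▸ Nat.mul_lt_mul_of_pos_left heP ht
  refine ⟨w, fun hw => ?_, ?_⟩
  · have hne : w ≠ c 1 := by
      intro h
      have h₁ : D 1 = 0 := LinearMap.ext_on_range hyspan fun i => by
        rw [← hwc 1 one_ne_zero, h, sub_self]
        rfl
      refine ha₀ (T.eq_zero_of_sum_mul_pow_apply_eq_zero (hTord ▸ heP) a (fun x => ?_) 0 e.succ_pos)
      have h₂ : D 1 x = 0 := by rw [h₁, LinearMap.zero_apply]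
      rw [hD, map_eq_zero_iff _ (σ ^ j).injective, mul_eq_zero,
        map_eq_zero_iff _ (σ ^ (t * e)).injective] at h₂
      rw [← hf]
      simpa [hβ] using h₂
    have h₁ : minDist K (evalCode α 𝒞) ≤ rankDist K w (c 1) :=
      Nat.sInf_le ⟨w, hw, c 1, hcC 1, hne, rfl⟩
    have h₂ := hdist 1 one_ne_zero
    omega
  · have hfib : ∀ γ ≠ 0, ∀ δ ≠ 0, c δ = c γ → γ⁻¹ * δ ∈ F := by
      intro γ hγ δ hδ h
      have hDD : D δ = D γ := hDinj δ γ fun i => by rw [← hwc δ hδ, ← hwc γ hγ, h]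
      have h₁ : ∀ x : N, (T ^ e) δ * f (δ⁻¹ * x) = (T ^ e) γ * f (γ⁻¹ * x) := by
        intro x
        have h₂ := LinearMap.congr_fun hDD x
        rw [hD, hD, EmbeddingLike.apply_eq_iff_eq, map_mul (σ ^ (t * e)), map_mul (σ ^ (t * e)),
          ← hTσ, ← hTσ, mul_assoc, mul_assoc] at h₂
        have h₃ := mul_left_cancel₀ ((map_ne_zero_iff _ (σ ^ (t * e)).injective).2 hβ) h₂
        exact_mod_cast h₃
      -- Only the constant coefficients are compared; `a 0 ≠ 0` can then be cancelled.
      have h₄ := T.eq_zero_of_sum_mul_pow_apply_eq_zero (e := e + 1) (hTord ▸ heP)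
        (fun i => (T ^ e) δ * a i * (T ^ i) δ⁻¹ - (T ^ e) γ * a i * (T ^ i) γ⁻¹) (fun x => by
          have h₅ := h₁ x
          rw [hf, hf, ← sub_eq_zero, Finset.mul_sum, Finset.mul_sum,
            ← Finset.sum_sub_distrib] at h₅
          rw [← h₅]
          refine Finset.sum_congr rfl fun i _ => ?_
          rw [map_mul, map_mul]
          ring) 0 e.succ_pos
      simp only [pow_zero, AlgEquiv.one_apply] at h₄
      have hTγ : (T ^ e) γ ≠ 0 := (map_ne_zero_iff _ (T ^ e).injective).2 hγ
      have h₆ : (T ^ e) (γ⁻¹ * δ) = γ⁻¹ * δ := by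
        rw [map_mul, map_inv₀]
        field_simp at h₄ ⊢
        have h₇ : a 0 * ((T ^ e) δ * γ) = a 0 * (δ * (T ^ e) γ) := by
          linear_combination h₄
        have := mul_left_cancel₀ ha₀ h₇
        linear_combination this
      -- `T` is itself a power of `T ^ e`, so anything fixed by `T ^ e` is fixed by `T`.
      obtain ⟨m, hm⟩ := exists_pow_eq_self_of_coprime (x := T) (hTord ▸ hcop)
      have h₈ : (T ^ e) ∈ MulAction.stabilizer (N ≃ₐ[K] N) (γ⁻¹ * δ) := h₆
      have h₉ := pow_mem h₈ m
      rw [hm] at h₉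
      exact (T.mem_fixedField_zpowers _).2 h₉
    have : Finite K := Finite.of_injective _ (algebraMap K L).injective
    have := Fintype.ofFinite N
    have := Fintype.ofFinite F
    have hcardN : (Finset.univ.erase (0 : N)).card = Nat.card K ^ finrank K N - 1 := by
      rw [Finset.card_erase_of_mem (Finset.mem_univ _), Finset.card_univ, ← Nat.card_eq_fintype_card,
        natCard_eq_pow_finrank (K := K)]
    have hcardF : (Finset.univ.erase (0 : F)).card = Nat.card K ^ t - 1 := by
      rw [Finset.card_erase_of_mem (Finset.mem_univ _), Finset.card_univ, ← Nat.card_eq_fintype_card,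
        natCard_eq_pow_finrank (K := K), hFrank]
    have hle := Finset.card_le_mul_card_image (f := c) (Finset.univ.erase (0 : N))
      (Nat.card K ^ t - 1) (by
        intro x hx
        obtain ⟨γ, hγ, rfl⟩ := Finset.mem_image.1 hx
        have hγ := Finset.ne_of_mem_erase hγ
        rw [← hcardF]
        refine (Finset.card_le_card (t := (Finset.univ.erase (0 : F)).image fun u : F => γ * (u : N))
          fun δ hδ => ?_).trans Finset.card_image_le
        obtain ⟨hδ, hδc⟩ := Finset.mem_filter.1 hδ
        have hδ := Finset.ne_of_mem_erase hδ
        refine Finset.mem_image.2 ⟨⟨γ⁻¹ * δ, hfib γ hγ δ hδ hδc⟩,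
          Finset.mem_erase.2 ⟨fun h => ?_, Finset.mem_univ _⟩, mul_inv_cancel_left₀ hγ δ⟩
        exact mul_ne_zero (inv_ne_zero hγ) hδ (congrArg Subtype.val h))
    rw [hcardN] at hle
    refine (Nat.div_le_of_le_mul hle).trans ?_
    rw [← Set.ncard_coe_finset]
    refine Set.ncard_le_ncard (fun x hx => ?_) (Set.toFinite _)
    obtain ⟨γ, hγ, rfl⟩ := Finset.mem_image.1 (Finset.mem_coe.1 hx)
    exact ⟨hcC γ, (hdist γ (Finset.ne_of_mem_erase hγ)).trans hτ⟩

/-! ### Arithmetic of `p_k` and the size bound -/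

/-- The source of the coprimality of `p_{k-1}` and `p_k`. -/
theorem geomSum_eq_mul_add_one (q' k : ℕ) (hk : 0 < k) :
    geomSum q' k = q' * geomSum q' (k - 1) + 1 := by
  rw [geomSum, Finset.sum_range_succ', geomSum, Finset.mul_sum, Nat.sub_add_cancel hk]
  simp [pow_succ']

theorem geomSum_eq_add_pow (q' k : ℕ) (hk : 0 < k) :
    geomSum q' k = geomSum q' (k - 1) + q' ^ k := by
  rw [geomSum, Finset.sum_range_succ, geomSum, Nat.sub_add_cancel hk]

theorem geomSum_pos (q' k : ℕ) : 0 < geomSum q' k := by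
  rw [geomSum, Finset.sum_range_succ']
  simp

/-- Already `q ^ (n - t)` is a lower bound, as `q ^ (n - t) * (q ^ t - 1) = q ^ n - q ^ (n - t)`. -/
theorem two_pow_sub_le_div {q n t : ℕ} (hq : 2 ≤ q) (ht : 0 < t) (htn : t ≤ n) :
    2 ^ (n - t) ≤ (q ^ n - 1) / (q ^ t - 1) := by
  have h₁ : 1 < q ^ t := Nat.one_lt_pow ht.ne' hq
  refine (Nat.pow_le_pow_left hq (n - t)).trans ?_
  rw [Nat.le_div_iff_mul_le (Nat.sub_pos_of_lt h₁), Nat.mul_sub, ← pow_add, Nat.sub_add_cancel htn,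
    mul_one]
  exact Nat.sub_le_sub_left (Nat.one_le_pow _ _ (by omega)) _

end RankMetric

/-! ### The main theorem -/

open RankMetric in
theorem mainTheorem7 {ι : Type*}
    -- the prime `p`, the parameters `k, t, r, s`, `q' = p ^ r`, and the length `n = t p_k`
    (p k t r s q' n : ι → ℕ)
    (hp : ∀ i, (p i).Prime) (hk : ∀ i, 0 < k i) (ht : ∀ i, 0 < t i)
    (hq' : ∀ i, q' i = p i ^ r i)
    (hn : ∀ i, n i = t i * geomSum (q' i) (k i))
    (hs : ∀ i, 0 < s i) (hsn : ∀ i, (s i).Coprime (n i))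
    -- the fields `K = 𝔽_q` and `N = 𝔽_{q^n} ⊆ L = 𝔽_{q^m}`, and `σ : x ↦ x^{q^s}`
    (K : ι → Type*) (L : ι → Type*) [∀ i, Field (K i)] [∀ i, Field (L i)]
    [∀ i, Finite (L i)] [∀ i, Algebra (K i) (L i)] [∀ i, CharP (K i) (p i)]
    (N : ∀ i, IntermediateField (K i) (L i))
    (hN : ∀ i, Module.finrank (K i) (N i) = n i)
    (σ : ∀ i, L i ≃ₐ[K i] L i)
    (hσ : ∀ i x, σ i x = x ^ (Nat.card (K i) ^ s i))
    -- the code `𝒞`, and its evaluation code over a basis `α` of `β N`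
    (𝒞 : ∀ i, Set (L i →ₗ[K i] L i)) (h𝒞 : ∀ i, 𝒞 i ⊆ sigmaPolynomials (σ i))
    (β : ∀ i, L i) (hβ : ∀ i, β i ≠ 0)
    (α : ∀ i, Fin (n i) → L i) (hα : ∀ i, LinearIndependent (K i) (α i))
    (hspan : ∀ i, (Submodule.span (K i) (Set.range (α i)) : Set (L i)) =
      (fun x => β i * x) '' (N i : Set (L i)))
    (d : ι → ℕ) (hd : ∀ i, d i = minDist (K i) (evalCode (α i) (𝒞 i)))
    (hd₁ : ∀ i, (d i - 1) / 2 + 1 ≤ t i * q' i ^ k i)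
    (hd₂ : ∀ i, t i * q' i ^ k i ≤ d i - 1)
    (j : ι → ℕ) (hj : ∀ i, j i < t i * q' i ^ k i)
    -- the coefficients lie in `𝔽_{q^n}(β)`, which is `𝔽_{q^n}` when `β ∈ 𝔽_{q^n}`
    (hG : ∀ i, sigmaTwist (σ i) (j i) (gabidulin (σ i)
        (N i ⊔ IntermediateField.adjoin (K i) {β i})
        (t i * (geomSum (q' i) (k i - 1) - geomSum (q' i) 0) + 1)) ⊆ 𝒞 i)
    (τ : ι → ℕ) (hτ : ∀ i, t i * q' i ^ k i ≤ τ i) :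
    (∀ i, ∃ w : Fin (n i) → L i, w ∉ evalCode (α i) (𝒞 i) ∧
      (Nat.card (K i) ^ n i - 1) / (Nat.card (K i) ^ t i - 1) ≤
        (evalCode (α i) (𝒞 i) ∩ rankBall (K i) w (τ i)).ncard) ∧
    ((∀ B : ℕ, ∃ i, B ≤ n i) →
      ¬ EfficientlyListDecodable K (fun i => evalCode (α i) (𝒞 i)) τ) := by
  have hq₀ : ∀ i, 0 < q' i := fun i => by
    rw [hq']
    exact pow_pos (hp i).pos _
  have main : ∀ i, ∃ w : Fin (n i) → L i, w ∉ evalCode (α i) (𝒞 i) ∧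
      (Nat.card (K i) ^ n i - 1) / (Nat.card (K i) ^ t i - 1) ≤
        (evalCode (α i) (𝒞 i) ∩ rankBall (K i) w (τ i)).ncard := by
    intro i
    have h₁ := geomSum_eq_add_pow (q' i) (k i) (hk i)
    have h₂ : n i - t i * geomSum (q' i) (k i - 1) = t i * q' i ^ k i := by
      rw [hn, h₁, mul_add, Nat.add_sub_cancel_left]
    have h₀ : geomSum (q' i) 0 = 1 := by simp [geomSum]
    refine exists_word_le_ncard_inter_rankBall (N i) (hN i) (hn i) (ht i)
      (geomSum_pos (q' i) (k i - 1)) ?_ ?_ (hsn i) (σ i) (hσ i) (𝒞 i) (hβ i) (α i) (hα i) (hspan i)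
      (h₂ ▸ hd i ▸ hd₂ i) (h₀ ▸ hG i) (h₂ ▸ hτ i)
    · rw [h₁]
      exact Nat.lt_add_of_pos_right (pow_pos (hq₀ i) _)
    · rw [geomSum_eq_mul_add_one _ _ (hk i)]
      simp
  refine ⟨main, fun hunb ⟨P, hP⟩ => ?_⟩
  obtain ⟨B, hB⟩ := exists_forall_add_eval_lt_two_pow P
  obtain ⟨i, hi⟩ := hunb B
  obtain ⟨M, hM⟩ := hP i
  obtain ⟨w, -, hw⟩ := main i
  -- Keeps `n - t` at least `n / 2`, so the list size is exponential in `n` even when `t` varies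
  -- along the family.
  have h₁ : 2 ≤ geomSum (q' i) (k i) := by
    rw [geomSum_eq_mul_add_one _ _ (hk i)]
    exact Nat.succ_le_succ (Nat.mul_pos (hq₀ i) (geomSum_pos _ _))
  have h₂ : 2 * t i ≤ n i := by
    rw [hn, mul_comm]
    exact Nat.mul_le_mul_left _ h₁
  have : Finite (K i) := Finite.of_injective _ (algebraMap (K i) (L i)).injective
  have h₃ := two_pow_sub_le_div (Finite.one_lt_card (α := K i)) (ht i)
    (show t i ≤ n i by omega)
  have h₄ := hB (n i) (t i) hi h₂
  have h₅ : (evalCode (α i) (𝒞 i) ∩ rankBall (K i) w (τ i)).ncard * n i ≤ n i + P.eval (n i) :=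
    hM.ncard_mul_le w
  have h₆ : 0 < n i := by have := ht i; omega
  have h₇ := Nat.le_mul_of_pos_right
    (evalCode (α i) (𝒞 i) ∩ rankBall (K i) w (τ i)).ncard h₆
  omega
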